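/- Let $G$ be a group with a finite presentation $\langle x_1,\dots,x_n\mid r_1,\dots,r_m\rangle$. Let $F_n$ be the free group on $x_1,\dots,x_n$ and let $D_j$ ($1\le j\le n$) be the Fox derivatives, that is, $D_j\colon F_n\to\mathbb{Z}[F_n]$ is determined by $D_j(x_i)=\delta_{ij}$ and $D_j(uv)=D_j(u)+u\,D_j(v)$. For a surjective homomorphism $\chi\colon G\to\mathbb{Z}$, the Alexander matrix relative to $\chi$ is the $m\times n$ matrix over $\mathbb{Z}[t^{\pm1}]$ whose $(i,j)$ entry is the image of $D_j(r_i)$ under the ring homomorphism $\mathbb{Z}[F_n]\to\mathbb{Z}[G]\to\mathbb{Z}[t^{\pm1}]$ that sends $w\in F_n$ to $t^{\chi(w)}$. The relative Alexander polynomial $\Delta_{G,\chi}\in\mathbb{Z}[t^{\pm1}]$ is the highest common factor, defined up to units, of the $(n-1)\times(n-1)$ minors of this matrix; it is $0$ if there are no such minors (that is, if $m<n-1$), and the empty minor, for $n=1$, is $1$. A finitely generated group is called large if it has a finite index subgroup that admits a homomorphism onto a non-abelian free group. (i) If $\chi\colon G\to\mathbb{Z}$ is a surjective homomorphism such that $\Delta_{G,\chi}=0$,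 where $\Delta_{G,\chi}$ is computed from the given presentation, then $G$ is large. (ii) If the presentation has deficiency $n-m\ge 2$, then there is a surjective homomorphism $\chi\colon G\to\mathbb{Z}$ with $\Delta_{G,\chi}=0$, and so $G$ is large (the Baumslag–Pride theorem). -/

import Mathlib

open scoped LaurentPolynomial

noncomputable section

/-- A group is large if it has a finite index subgroup admitting a homomorphism onto a
non-abelian free group. (A free group is non-abelian precisely when its rank is at least `2`, and
a group that surjects onto a free group of infinite rank also surjects onto the free group of
rank `2`, so that only finite ranks have to be mentioned.) -/
def IsLargeGroup (G : Type*) [Group G] : Prop :=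
  ∃ H : Subgroup G, H.FiniteIndex ∧
    ∃ k : ℕ, 2 ≤ k ∧ ∃ f : H →* FreeGroup (Fin k), Function.Surjective f

/-- A finite presentation `⟨x₁, …, xₙ | r₁, …, rₘ⟩` of the group `G`: the canonical map `proj`
from the free group on the generators onto `G` has as its kernel the normal closure of the
relators. -/
structure FinitePresentation (G : Type*) [Group G] where
  /-- the number `n` of generators -/
  numGen : ℕ
  /-- the number `m` of relators -/
  numRel : ℕ
  /-- the relators -/
  rel : Fin numRel → FreeGroup (Fin numGen)
  /-- the canonical map to `G` -/
  proj : FreeGroup (Fin numGen) →* G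
  proj_surjective : Function.Surjective proj
  ker_proj : proj.ker = Subgroup.normalClosure (Set.range rel)

/-- A group has a finite presentation if and only if it is finitely presented in Mathlib's sense. -/
theorem nonempty_finitePresentation_iff (G : Type*) [Group G] :
    Nonempty (FinitePresentation G) ↔ Group.IsFinitelyPresented G := by
  constructor
  · rintro ⟨P⟩
    exact ⟨P.numGen, P.proj, P.proj_surjective, Set.range P.rel, Set.finite_range _,
      P.ker_proj.symm⟩
  · rintro ⟨n, φ, hφ, S, hS, hker⟩
    obtain ⟨m, r, -, hr⟩ := hS.fin_param
    exact ⟨⟨n, m, r, φ, hφ, by rw [hr, hker]⟩⟩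

section Fox

variable {α : Type*} [DecidableEq α]

/-- The Fox derivative with respect to the generator `j` of a (not necessarily reduced) word,
in which `(i, true)` stands for `xᵢ` and `(i, false)` for `xᵢ⁻¹`; it is computed from
`D(xᵢ w) = δᵢⱼ + xᵢ D(w)` and `D(xᵢ⁻¹ w) = -xᵢ⁻¹ δᵢⱼ + xᵢ⁻¹ D(w)`. -/
def foxWord (j : α) : List (α × Bool) → MonoidAlgebra ℤ (FreeGroup α)
  | [] => 0
  | (i, true) :: w =>
      (if i = j then 1 else 0) + MonoidAlgebra.of ℤ _ (FreeGroup.of i) * foxWord j w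
  | (i, false) :: w =>
      MonoidAlgebra.of ℤ _ (FreeGroup.of i)⁻¹ * (foxWord j w - if i = j then 1 else 0)

theorem foxWord_append (j : α) (v w : List (α × Bool)) :
    foxWord j (v ++ w) =
      foxWord j v + MonoidAlgebra.of ℤ _ (FreeGroup.mk v) * foxWord j w := by
  induction v with
  | nil => rw [← FreeGroup.one_eq_mk, map_one, one_mul, List.nil_append, foxWord, zero_add]
  | cons a v ih =>
    obtain ⟨i, b⟩ := a
    have h : FreeGroup.mk ((i, b) :: v) = FreeGroup.mk [(i, b)] * FreeGroup.mk v := by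
      simp [FreeGroup.mul_mk]
    rw [h, map_mul]
    cases b
    · have h' : FreeGroup.mk [(i, false)] = (FreeGroup.of i)⁻¹ := by
        simp [FreeGroup.of, FreeGroup.inv_mk, FreeGroup.invRev]
      rw [h', List.cons_append, foxWord, foxWord, ih]
      noncomm_ring
    · have h' : FreeGroup.mk [(i, true)] = FreeGroup.of i := rfl
      rw [h', List.cons_append, foxWord, foxWord, ih]
      noncomm_ring

theorem foxWord_step (j : α) (v w : List (α × Bool)) (h : FreeGroup.Red.Step v w) :
    foxWord j v = foxWord j w := by
  rcases h with @⟨L₁, L₂, x, b⟩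
  rw [foxWord_append, foxWord_append]
  have hinv : MonoidAlgebra.of ℤ _ (FreeGroup.of x) * MonoidAlgebra.of ℤ _ (FreeGroup.of x)⁻¹ = 1 := by
    rw [← map_mul, mul_inv_cancel, map_one]
  have hinv' : MonoidAlgebra.of ℤ _ (FreeGroup.of x)⁻¹ * MonoidAlgebra.of ℤ _ (FreeGroup.of x) = 1 := by
    rw [← map_mul, inv_mul_cancel, map_one]
  congr 2
  cases b
  · simp only [Bool.not_false, foxWord, add_sub_cancel_left, ← mul_assoc, hinv', one_mul]
  · simp only [Bool.not_true, foxWord, ← mul_assoc, hinv, one_mul, add_sub_cancel]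

/-- The Fox derivative `D_j : F → ℤ[F]` on the free group `F`. It is the restriction to group
elements of the free derivation `ℤ[F] → ℤ[F]` with `D_j(xᵢ) = δᵢⱼ`, and is determined by the rules
`foxDerivative_of` and `foxDerivative_mul` below. -/
def foxDerivative (j : α) : FreeGroup α → MonoidAlgebra ℤ (FreeGroup α) :=
  Quot.lift (foxWord j) (foxWord_step j)

theorem foxDerivative_of (j i : α) :
    foxDerivative j (FreeGroup.of i) = if i = j then 1 else 0 := by
  change foxWord j [(i, true)] = _
  simp [foxWord]

theorem foxDerivative_mul (j : α) (u v : FreeGroup α) :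
    foxDerivative j (u * v) =
      foxDerivative j u + MonoidAlgebra.of ℤ _ u * foxDerivative j v := by
  induction u using Quot.ind with | _ u => ?_
  induction v using Quot.ind with | _ v => ?_
  exact foxWord_append j u v

end Fox

/-- `ℤ[t, t⁻¹]` is a unique factorization domain, so that highest common factors exist in it. -/
theorem isGCDMonoid_laurentInt : IsGCDMonoid ℤ[T;T⁻¹] := by
  have : UniqueFactorizationMonoid ℤ[T;T⁻¹] :=
    UniqueFactorizationMonoid.of_isLocalization
      (Submonoid.powers (Polynomial.X : Polynomial ℤ)) ℤ[T;T⁻¹]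
  exact ⟨UniqueFactorizationMonoid.toGCDMonoid _⟩

/-- A highest common factor of a finite family in `ℤ[t, t⁻¹]`. It is only determined up to units;
the highest common factor of the empty family is `0`. -/
def laurentGCD {ι : Type*} [Fintype ι] (f : ι → ℤ[T;T⁻¹]) : ℤ[T;T⁻¹] :=
  haveI : IsGCDMonoid ℤ[T;T⁻¹] := isGCDMonoid_laurentInt
  letI : NormalizedGCDMonoid ℤ[T;T⁻¹] := Classical.choice inferInstance
  Finset.univ.gcd f

theorem dvd_laurentGCD_iff {ι : Type*} [Fintype ι] (f : ι → ℤ[T;T⁻¹]) (d : ℤ[T;T⁻¹]) :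
    d ∣ laurentGCD f ↔ ∀ i, d ∣ f i := by
  unfold laurentGCD
  simp only [Finset.dvd_gcd_iff, Finset.mem_univ, true_imp_iff]

namespace FinitePresentation

variable {G : Type*} [Group G] (P : FinitePresentation G)

/-- The deficiency `n - m` of a presentation with `n` generators and `m` relators. -/
def deficiency : ℤ := (P.numGen : ℤ) - (P.numRel : ℤ)

/-- The ring homomorphism `ℤ[Fₙ] → ℤ[G] → ℤ[ℤ] = ℤ[t, t⁻¹]` induced by `χ : G → ℤ`; it sends a
word `w` to `t ^ χ(w)`. -/
def evalHom (χ : G →* Multiplicative ℤ) :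
    MonoidAlgebra ℤ (FreeGroup (Fin P.numGen)) →+* ℤ[T;T⁻¹] :=
  (MonoidAlgebra.lift ℤ ℤ[T;T⁻¹] (FreeGroup (Fin P.numGen))
    ((AddMonoidAlgebra.of ℤ ℤ).comp (χ.comp P.proj))).toRingHom

theorem evalHom_of (χ : G →* Multiplicative ℤ) (w : FreeGroup (Fin P.numGen)) :
    P.evalHom χ (MonoidAlgebra.of ℤ _ w) =
      LaurentPolynomial.T (Multiplicative.toAdd (χ (P.proj w))) := by
  change MonoidAlgebra.lift ℤ ℤ[T;T⁻¹] _ _ _ = _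
  rw [MonoidAlgebra.lift_of]
  rfl

/-- The `m × n` Alexander matrix relative to `χ`: its `(i, j)` entry is the image of the Fox
derivative `D_j(r_i)` in `ℤ[t, t⁻¹]`. -/
def alexanderMatrix (χ : G →* Multiplicative ℤ) :
    Matrix (Fin P.numRel) (Fin P.numGen) ℤ[T;T⁻¹] :=
  Matrix.of fun i j => P.evalHom χ (foxDerivative j (P.rel i))

/-- The `(n - 1) × (n - 1)` minors of the Alexander matrix, indexed by a choice of `n - 1` rows and
a choice of `n - 1` columns. If `m < n - 1`, there are none. (A group with a homomorphism onto `ℤ`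
has `n ≥ 1`; for `n = 1` the only minor is the empty determinant `1`.) -/
def alexanderMinor (χ : G →* Multiplicative ℤ)
    (s : (Fin (P.numGen - 1) ↪o Fin P.numRel) × (Fin (P.numGen - 1) ↪o Fin P.numGen)) :
    ℤ[T;T⁻¹] :=
  ((P.alexanderMatrix χ).submatrix s.1 s.2).det

/-- The Alexander polynomial `Δ_{G,χ} ∈ ℤ[t, t⁻¹]` relative to `χ : G → ℤ`, computed from the
presentation `P`: the highest common factor of the `(n - 1) × (n - 1)` minors of the Alexander
matrix. It is well defined up to units, and it is `0` if there are no such minors. -/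
def relAlexanderPolynomial (χ : G →* Multiplicative ℤ) : ℤ[T;T⁻¹] :=
  laurentGCD (P.alexanderMinor χ)

end FinitePresentation

end

noncomputable section

/-! ### Largeness from a non-commutative free image. -/

section Large

/-! If `Δ = 0`, the Alexander matrix has rank below `n - 1` over the fraction field, so its kernel
contains a vector `c` over `ℤ[t, t⁻¹]` that is not proportional to the principal vector `(t ^ χ(xᵢ)
- 1)ᵢ`. The derivation of `Fₙ` with values `c` kills the relators and, not being principal up to
scalars, is nonzero at some `w` with `χ(w) = 0` (`sub_one_mul_eq_of_foxCombination_eq_zero`). Its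
coefficients form a finitely supported integral 1-cocycle on the infinite cyclic cover that is
nonzero on a loop (`pathLabel_coeff`).

Cut the cover into blocks of large length `p = 2D + 1`, and put into block `q` a copy of the cocycle
with values in the cyclic group generated by `a^q b a^(-q)`, where `a, b` generate a free group.
Every lift of a relator meets the support of at most one copy, so this is still a cocycle
(`pathLabel_blockLabel`), and translation by `p` acts as conjugation by `a`. It therefore gives a
homomorphism from the finite index subgroup `χ⁻¹(pℤ)` to the free group. The loop goes to `b^d` with
`d ≠ 0`, and an element with `χ = p` goes to one of exponent sum one in `a`; these do not commute,
and Nielsen–Schreier gives largeness (`isLargeGroup_of_pathLabel`).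

In deficiency at least two there are no minors, so `Δ = 0` for every `χ`, and linear algebra over
`ℤ` supplies a surjective one. -/

theorem commute_freeGroup_of_subsingleton {ι : Type*} [Subsingleton ι] (x y : FreeGroup ι) :
    x * y = y * x := by
  have hof : ∀ i, FreeGroup.of i * y = y * FreeGroup.of i := by
    intro i
    induction y using FreeGroup.induction_on with
    | C1 => simp
    | of j => rw [Subsingleton.elim i j]
    | inv_of j _ => rw [Subsingleton.elim i j]; simp
    | mul a b ha hb => rw [← mul_assoc, ha, mul_assoc, hb, mul_assoc]
  induction x using FreeGroup.induction_on with
  | C1 => simp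
  | of i => exact hof i
  | inv_of i _ => exact (Commute.inv_left (hof i) : Commute _ _)
  | mul a b ha hb => rw [mul_assoc, hb, ← mul_assoc, ha, mul_assoc]

theorem exists_surjective_freeGroup_fin_two {ι : Type*} [Nontrivial ι] :
    ∃ f : FreeGroup ι →* FreeGroup (Fin 2), Function.Surjective f := by
  classical
  obtain ⟨i, j, hij⟩ := exists_pair_ne ι
  refine ⟨FreeGroup.lift fun l =>
    if l = i then FreeGroup.of 0 else if l = j then FreeGroup.of 1 else 1, ?_⟩
  rw [← MonoidHom.range_eq_top, eq_top_iff, ← FreeGroup.closure_range_of, Subgroup.closure_le]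
  rintro _ ⟨l, rfl⟩
  fin_cases l
  · exact ⟨FreeGroup.of i, by simp⟩
  · exact ⟨FreeGroup.of j, by simp [hij.symm]⟩

/-- By the Nielsen–Schreier theorem, a finite index subgroup with a non-commutative image in some
free group suffices for a group to be large. -/
theorem IsLargeGroup.of_not_commute {G : Type*} [Group G] {ι : Type*} (H : Subgroup G)
    [hH : H.FiniteIndex] (f : H →* FreeGroup ι) (x y : H) (hxy : f x * f y ≠ f y * f x) :
    IsLargeGroup G := by
  let e := IsFreeGroup.toFreeGroup f.range
  have : Nontrivial (IsFreeGroup.Generators f.range) := by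
    by_contra h
    rw [not_nontrivial_iff_subsingleton] at h
    apply hxy
    have h1 := commute_freeGroup_of_subsingleton (e (f.rangeRestrict x)) (e (f.rangeRestrict y))
    rw [← map_mul e, ← map_mul e, ← map_mul f.rangeRestrict, ← map_mul f.rangeRestrict] at h1
    simpa using congrArg Subtype.val (e.injective h1)
  obtain ⟨g, hg⟩ := exists_surjective_freeGroup_fin_two (ι := IsFreeGroup.Generators f.range)
  exact ⟨H, hH, 2, le_rfl, g.comp (e.toMonoidHom.comp f.rangeRestrict),
    hg.comp (e.surjective.comp f.rangeRestrict_surjective)⟩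

end Large

/-! ### Labelled paths in the infinite cyclic cover. -/

section PathLabel

variable {ι : Type*} {Γ Δ : Type*} [Group Γ] [Group Δ]

/-- The action of `ℤ` on functions on `ℤ` by translation of the argument. -/
def translationAction (Γ : Type*) [Group Γ] : Multiplicative ℤ →* MulAut (ℤ → Γ) where
  toFun n :=
    { toFun := fun f k => f (k + n.toAdd)
      invFun := fun f k => f (k - n.toAdd)
      left_inv := fun f => by ext k; simp
      right_inv := fun f => by ext k; simp
      map_mul' := fun f g => rfl }
  map_one' := by ext f k; simp
  map_mul' m n := by ext f k; simp [add_assoc]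

/-- The homomorphism to the unrestricted wreath product with `ℤ` defined by labels on the edges of
the infinite cyclic cover of a bouquet of circles corresponding to `χ`. The edge that starts at
`k` and covers the `i`-th circle carries the label `A i k`. -/
def pathHom (χ : FreeGroup ι →* Multiplicative ℤ) (A : ι → ℤ → Γ) :
    FreeGroup ι →* (ℤ → Γ) ⋊[translationAction Γ] Multiplicative ℤ :=
  FreeGroup.lift fun i => ⟨A i, χ (FreeGroup.of i)⟩

/-- The product of the labels along the lift of the word `w` that starts at `k`. -/
def pathLabel (χ : FreeGroup ι →* Multiplicative ℤ) (A : ι → ℤ → Γ) (w : FreeGroup ι) (k : ℤ) :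
    Γ :=
  (pathHom χ A w).left k

variable (χ : FreeGroup ι →* Multiplicative ℤ) (A : ι → ℤ → Γ)

theorem pathHom_right (w : FreeGroup ι) : (pathHom χ A w).right = χ w := by
  have : SemidirectProduct.rightHom.comp (pathHom χ A) = χ := by
    ext i
    simp [pathHom]
  exact DFunLike.congr_fun this w

@[simp]
theorem pathLabel_of (i : ι) (k : ℤ) : pathLabel χ A (FreeGroup.of i) k = A i k := by
  simp [pathLabel, pathHom]

@[simp]
theorem pathLabel_one (k : ℤ) : pathLabel χ A 1 k = 1 := by
  simp [pathLabel]

theorem pathLabel_mul (u v : FreeGroup ι) (k : ℤ) :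
    pathLabel χ A (u * v) k = pathLabel χ A u k * pathLabel χ A v (k + (χ u).toAdd) := by
  rw [← pathHom_right χ A u]
  rw [pathLabel, map_mul, SemidirectProduct.mul_left]
  rfl

theorem pathLabel_inv (u : FreeGroup ι) (k : ℤ) :
    pathLabel χ A u⁻¹ k = (pathLabel χ A u (k - (χ u).toAdd))⁻¹ := by
  have h := pathLabel_mul χ A u⁻¹ u k
  rw [inv_mul_cancel, pathLabel_one, map_inv, toAdd_inv, ← sub_eq_add_neg] at h
  exact eq_inv_of_mul_eq_one_left h.symm

theorem map_pathLabel (f : Γ →* Δ) (w : FreeGroup ι) (k : ℤ) :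
    f (pathLabel χ A w k) = pathLabel χ (fun i l => f (A i l)) w k := by
  induction w using FreeGroup.induction_on generalizing k with
  | C1 => simp
  | of i => simp
  | inv_of i h => simp [pathLabel_inv]
  | mul u v hu hv => simp [pathLabel_mul, hu, hv]

theorem pathLabel_add (d : ℤ) (w : FreeGroup ι) (k : ℤ) :
    pathLabel χ A w (k + d) = pathLabel χ (fun i l => A i (l + d)) w k := by
  induction w using FreeGroup.induction_on generalizing k with
  | C1 => simp
  | of i => simp
  | inv_of i h => simp [pathLabel_inv, sub_add_eq_add_sub]
  | mul u v hu hv => simp [pathLabel_mul, ← hu, ← hv, add_right_comm]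

/-- A lift of `w` stays within bounded distance of its starting point. The bound does not depend on
the labels, so the block length can be chosen before the block labels are built. -/
theorem exists_radius_pathLabel (Γ : Type*) [Group Γ] (w : FreeGroup ι) :
    ∃ R : ℤ, ∀ (A B : ι → ℤ → Γ) (k : ℤ), (∀ i l, |l - k| ≤ R → A i l = B i l) →
      pathLabel χ A w k = pathLabel χ B w k := by
  induction w using FreeGroup.induction_on with
  | C1 => exact ⟨0, fun A B k _ => by simp⟩
  | of i => exact ⟨0, fun A B k h => by simpa using h i k (by simp)⟩
  | inv_of i _ =>
    refine ⟨|(χ (FreeGroup.of i)).toAdd|, fun A B k h => ?_⟩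
    rw [pathLabel_inv, pathLabel_inv, pathLabel_of, pathLabel_of, h i _ (by simp)]
  | mul u v hu hv =>
    obtain ⟨R, hR⟩ := hu
    obtain ⟨S, hS⟩ := hv
    refine ⟨max R (S + |(χ u).toAdd|), fun A B k h => ?_⟩
    rw [pathLabel_mul, pathLabel_mul, hR A B k fun i l hl => h i l (hl.trans (le_max_left _ _)),
      hS A B _ fun i l hl => h i l (le_max_of_le_right ?_)]
    have := abs_add_le (l - (k + (χ u).toAdd)) (χ u).toAdd
    rw [show l - (k + (χ u).toAdd) + (χ u).toAdd = l - k by ring] at this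
    linarith

end PathLabel

/-- An element of exponent sum one in the first generator of a free group of rank two does not
commute with a nontrivial power of the second generator. -/
theorem not_commute_zpow_of_exponent_eq_one (g : FreeGroup (Fin 2)) (d : ℤ) (hd : d ≠ 0)
    (hg : FreeGroup.lift (fun i : Fin 2 => if i = 0 then Multiplicative.ofAdd (1 : ℤ) else 1) g =
      Multiplicative.ofAdd 1) :
    g * FreeGroup.of 1 ^ d ≠ FreeGroup.of 1 ^ d * g := by
  set σ : FreeGroup (Fin 2) →* Multiplicative ℤ :=
    FreeGroup.lift (fun i : Fin 2 => if i = 0 then Multiplicative.ofAdd (1 : ℤ) else 1)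
  -- In the cover counting exponents of the first generator, only the second generator's loop at
  -- height `0` is labelled. From `0`, the power is read at height `0` if it comes first, but at the
  -- unlabelled height `1` if it comes after `g`.
  let A : Fin 2 → ℤ → Multiplicative ℤ :=
    fun i k => if i = 1 ∧ k = 0 then Multiplicative.ofAdd 1 else 1
  have hpow : ∀ k, pathLabel σ A (FreeGroup.of 1 ^ d) k = A 1 k ^ d := by
    intro k
    have h1 : pathHom σ A (FreeGroup.of 1) = SemidirectProduct.inl (A 1) := by
      ext <;> simp [pathHom, σ]
    rw [pathLabel, map_zpow, h1, ← map_zpow]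
    rfl
  intro h
  have h2 := congrArg (fun w => pathLabel σ A w 0) h
  simp only [pathLabel_mul, hpow, hg, map_zpow] at h2
  rw [show σ (FreeGroup.of 1) = 1 by simp [σ]] at h2
  rw [mul_comm] at h2
  simp [A, ← ofAdd_zsmul] at h2
  exact hd h2

/-! ### Spreading a finitely supported cocycle over blocks. -/

section Block

/-- The index of the block of length `2 * D + 1`, centred at a multiple of `2 * D + 1`, to which `k`
belongs. -/
def blockIndex (D k : ℤ) : ℤ := (k + D) / (2 * D + 1)

theorem blockIndex_add {D : ℤ} (hD : 0 ≤ D) (k : ℤ) :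
    blockIndex D (k + (2 * D + 1)) = blockIndex D k + 1 := by
  unfold blockIndex
  rw [add_right_comm, Int.add_ediv_of_dvd_right (dvd_refl _), Int.ediv_self (ne_of_gt (by linarith only [hD]))]

theorem abs_sub_blockIndex_le {D : ℤ} (hD : 0 ≤ D) (k : ℤ) :
    |k - (2 * D + 1) * blockIndex D k| ≤ D := by
  have h1 := Int.emod_add_mul_ediv (k + D) (2 * D + 1)
  have h2 := Int.emod_nonneg (k + D) (show 2 * D + 1 ≠ 0 by omega)
  have h3 := Int.emod_lt_of_pos (k + D) (show 0 < 2 * D + 1 by omega)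
  unfold blockIndex
  rw [abs_le]
  constructor <;> linarith

theorem blockIndex_eq_zero {D k : ℤ} (hk : |k| ≤ D) : blockIndex D k = 0 := by
  rw [abs_le] at hk
  exact Int.ediv_eq_zero_of_lt (by linarith) (by linarith)

/-- A function supported near the centre of the block around `0`, and its translate to the
block of `k`, agree near `k` with the periodic extension of the function. -/
theorem periodic_eq_of_abs_sub_le {D M R k l : ℤ} (hD : 0 ≤ D) (hMR : M + R ≤ D) {c : ℤ → ℤ}
    (hc : ∀ x, M < |x| → c x = 0) (hl : |l - k| ≤ R) (hq : blockIndex D l ≠ blockIndex D k) :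
    c (l - (2 * D + 1) * blockIndex D l) = 0 ∧ c (l - (2 * D + 1) * blockIndex D k) = 0 := by
  have hk := abs_sub_blockIndex_le hD k
  have hl' := abs_sub_blockIndex_le hD l
  set q := blockIndex D k
  set q' := blockIndex D l
  have h1 : 2 * D + 1 ≤ |(2 * D + 1) * (q' - q)| := by
    rw [abs_mul, abs_of_nonneg (by omega : 0 ≤ 2 * D + 1)]
    have : 1 ≤ |q' - q| := Int.one_le_abs (sub_ne_zero.2 hq)
    nlinarith
  have h2 : |l - (2 * D + 1) * q| ≤ D + R := by
    have := abs_add_le (k - (2 * D + 1) * q) (l - k)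
    rw [show k - (2 * D + 1) * q + (l - k) = l - (2 * D + 1) * q by ring] at this
    linarith
  have h3 : 2 * D + 1 ≤ |l - (2 * D + 1) * q| + |l - (2 * D + 1) * q'| := by
    have := abs_sub (l - (2 * D + 1) * q) (l - (2 * D + 1) * q')
    rw [show l - (2 * D + 1) * q - (l - (2 * D + 1) * q') = (2 * D + 1) * (q' - q) by ring] at this
    linarith
  -- By `hl'` and `h3` the distance to the centre for `q` is at least `D + 1`; by `h2` and `h3` the
  -- distance to the centre for `q'` is at least `D + 1 - R`. Both exceed `M`.
  have hR := (abs_nonneg (l - k)).trans hl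
  exact ⟨hc _ (by linarith), hc _ (by linarith)⟩

variable {ι : Type*}

/-- The labels with values in a free group of rank two that are powers of the second generator,
with exponents `c` in the block around `0`, and conjugated by powers of the first generator in the
other blocks. -/
def blockLabel (D : ℤ) (c : ι → ℤ → ℤ) (i : ι) (k : ℤ) : FreeGroup (Fin 2) :=
  MulAut.conj (FreeGroup.of 0 ^ blockIndex D k)
    (FreeGroup.of 1 ^ c i (k - (2 * D + 1) * blockIndex D k))

theorem pathLabel_blockLabel_add {D : ℤ} (hD : 0 ≤ D) (χ : FreeGroup ι →* Multiplicative ℤ)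
    (c : ι → ℤ → ℤ) (w : FreeGroup ι) (k : ℤ) :
    pathLabel χ (blockLabel D c) w (k + (2 * D + 1)) =
      MulAut.conj (FreeGroup.of 0) (pathLabel χ (blockLabel D c) w k) := by
  rw [pathLabel_add]
  refine Eq.trans ?_ (map_pathLabel χ _ (MulAut.conj (FreeGroup.of 0)).toMonoidHom w k).symm
  congr 1
  ext i l
  simp only [blockLabel, blockIndex_add hD, MulEquiv.toMonoidHom_eq_coe, MonoidHom.coe_coe]
  rw [← MulAut.mul_apply, ← map_mul, ← zpow_one_add, add_comm 1]
  congr 3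
  ring

/-- Within distance `R` of `k`, labels outside the block of `k` are trivial. The path thus sees one
conjugated cyclic copy only, the image of the integer labels under a homomorphism. -/
theorem pathLabel_blockLabel {D M R : ℤ} (hD : 0 ≤ D) (hMR : M + R ≤ D)
    (χ : FreeGroup ι →* Multiplicative ℤ) {c : ι → ℤ → ℤ} (hc : ∀ i x, M < |x| → c i x = 0)
    (w : FreeGroup ι)
    (hw : ∀ (A B : ι → ℤ → FreeGroup (Fin 2)) (k : ℤ), (∀ i l, |l - k| ≤ R → A i l = B i l) →
      pathLabel χ A w k = pathLabel χ B w k) (k : ℤ) :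
    pathLabel χ (blockLabel D c) w k = MulAut.conj (FreeGroup.of 0 ^ blockIndex D k)
      (zpowersHom _ (FreeGroup.of 1) (pathLabel χ (fun i l => Multiplicative.ofAdd (c i l)) w
        (k - (2 * D + 1) * blockIndex D k))) := by
  rw [sub_eq_add_neg, pathLabel_add, map_pathLabel]
  refine Eq.trans ?_ (map_pathLabel χ _
    (MulAut.conj (FreeGroup.of 0 ^ blockIndex D k)).toMonoidHom w k).symm
  refine hw _ _ _ fun i l hl => ?_
  simp only [blockLabel, zpowersHom_apply, toAdd_ofAdd, MulEquiv.toMonoidHom_eq_coe,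
    MonoidHom.coe_coe, ← sub_eq_add_neg]
  by_cases hq : blockIndex D l = blockIndex D k
  · rw [hq]
  · obtain ⟨h1, h2⟩ := periodic_eq_of_abs_sub_le hD hMR (hc i) hl hq
    rw [h1, h2, zpow_zero, map_one, map_one]

theorem exponent_pathLabel_blockLabel (D : ℤ) (χ : FreeGroup ι →* Multiplicative ℤ)
    (c : ι → ℤ → ℤ) (w : FreeGroup ι) (k : ℤ) :
    FreeGroup.lift (fun i : Fin 2 => if i = 0 then Multiplicative.ofAdd (1 : ℤ) else 1)
      (pathLabel χ (blockLabel D c) w k) = 1 := by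
  rw [map_pathLabel]
  -- Each label is a conjugate of a power of the second generator, so its exponent sum in the first
  -- is zero: the labels come from the trivial group `Unit`.
  have h : (fun (i : ι) (l : ℤ) => FreeGroup.lift (fun i : Fin 2 =>
      if i = 0 then Multiplicative.ofAdd (1 : ℤ) else 1) (blockLabel D c i l)) =
      fun i l => (1 : Unit →* Multiplicative ℤ) 1 := by
    ext i l
    simp only [blockLabel, MulAut.conj_apply]
    simp
  rw [h, ← map_pathLabel χ (fun _ _ => 1) (1 : Unit →* Multiplicative ℤ)]
  rfl

end Block

/-! ### The homomorphism from a finite index subgroup to a free group. -/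

section Cover

variable {G : Type*} [Group G] (P : FinitePresentation G)

/-- Labels along which all lifts of the relators are trivial define a map on the group. -/
theorem FinitePresentation.exists_pathLabel_factor {Γ : Type*} [Group Γ]
    (χ : G →* Multiplicative ℤ) (A : Fin P.numGen → ℤ → Γ)
    (hrel : ∀ j k, pathLabel (χ.comp P.proj) A (P.rel j) k = 1) :
    ∃ B : G → ℤ → Γ, ∀ w k, B (P.proj w) k = pathLabel (χ.comp P.proj) A w k := by
  have hker : P.proj.ker ≤ (pathHom (χ.comp P.proj) A).ker := by
    rw [P.ker_proj]
    refine Subgroup.normalClosure_le_normal ?_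
    rintro _ ⟨j, rfl⟩
    refine SemidirectProduct.ext (funext fun k => hrel j k) ?_
    have : P.rel j ∈ P.proj.ker := P.ker_proj ▸ Subgroup.subset_normalClosure ⟨j, rfl⟩
    rw [pathHom_right, MonoidHom.comp_apply, MonoidHom.mem_ker.1 this]
    simp
  refine ⟨fun g k => (P.proj.liftOfSurjective P.proj_surjective ⟨_, hker⟩ g).left k, fun w k => ?_⟩
  simp only [MonoidHom.liftOfRightInverse_comp_apply]
  rfl

theorem FinitePresentation.isLargeGroup_of_pathLabel (χ : G →* Multiplicative ℤ)
    (hχ : Function.Surjective χ) (c : Fin P.numGen → ℤ → ℤ)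
    (hc : ∃ M : ℤ, ∀ i x, M < |x| → c i x = 0)
    (hrel : ∀ j k, pathLabel (χ.comp P.proj) (fun i l => Multiplicative.ofAdd (c i l))
      (P.rel j) k = 1)
    (w : FreeGroup (Fin P.numGen)) (hw : χ (P.proj w) = 1) (k : ℤ)
    (hk : pathLabel (χ.comp P.proj) (fun i l => Multiplicative.ofAdd (c i l)) w k ≠ 1) :
    IsLargeGroup G := by
  obtain ⟨M, hM⟩ := hc
  choose R hR using fun v => exists_radius_pathLabel (χ.comp P.proj) (FreeGroup (Fin 2)) v
  -- `D` must put `k` into block `0` and make the blocks long compared with `w` and all relators.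
  obtain ⟨D, hDk, hDw, hDr⟩ : ∃ D : ℕ, |k| ≤ D ∧ M + R w ≤ D ∧ ∀ j, M + R (P.rel j) ≤ D := by
    refine ⟨|k|.toNat + (M + R w).toNat + ∑ j, (M + R (P.rel j)).toNat, ?_, ?_, fun j => ?_⟩
    · have := Int.self_le_toNat |k|; omega
    · have := Int.self_le_toNat (M + R w); omega
    · have := Finset.single_le_sum (f := fun j => (M + R (P.rel j)).toNat)
        (fun _ _ => Nat.zero_le _) (Finset.mem_univ j)
      have := Int.self_le_toNat (M + R (P.rel j))
      omega
  have hD : (0 : ℤ) ≤ D := Int.natCast_nonneg D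
  obtain ⟨B, hB⟩ := P.exists_pathLabel_factor χ (blockLabel D c) fun j l => by
    rw [pathLabel_blockLabel hD (hDr j) _ hM _ (hR _), hrel, map_one, map_one]
  have hBmul : ∀ g h l, B (g * h) l = B g l * B h (l + (χ g).toAdd) := by
    intro g h l
    obtain ⟨u, rfl⟩ := P.proj_surjective g
    obtain ⟨v, rfl⟩ := P.proj_surjective h
    rw [← map_mul, hB, hB, hB, pathLabel_mul]
    rfl
  have hBadd : ∀ g l, B g (l + (2 * D + 1)) = MulAut.conj (FreeGroup.of 0) (B g l) := by
    intro g l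
    obtain ⟨u, rfl⟩ := P.proj_surjective g
    rw [hB, hB, pathLabel_blockLabel_add hD]
  have hBadd' : ∀ g l (m : ℤ),
      B g (l + (2 * D + 1) * m) = MulAut.conj (FreeGroup.of 0 ^ m) (B g l) := by
    intro g l m
    induction m using Int.induction_on with
    | zero => simp
    | succ m ih =>
      rw [mul_add, mul_one, ← add_assoc, hBadd, ih, ← MulAut.mul_apply, ← map_mul,
        ← zpow_one_add, add_comm 1]
    | pred m ih =>
      apply (MulAut.conj (FreeGroup.of (0 : Fin 2))).injective
      rw [← hBadd, ← MulAut.mul_apply, ← map_mul, ← zpow_one_add,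
        show 1 + (-(m : ℤ) - 1) = -m by ring, ← ih]
      congr 1
      ring
  let φ : G →* Multiplicative (ZMod (2 * D + 1)) :=
    (AddMonoidHom.toMultiplicative (Int.castAddHom (ZMod (2 * D + 1)))).comp χ
  have hφ : ∀ g, g ∈ φ.ker ↔ (2 * D + 1 : ℤ) ∣ (χ g).toAdd := by
    intro g
    have := ZMod.intCast_zmod_eq_zero_iff_dvd (χ g).toAdd (2 * D + 1)
    push_cast at this
    rw [← this]
    rfl
  have hfin : Finite (Multiplicative (ZMod (2 * D + 1))) := inferInstanceAs (Finite (ZMod _))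
  have hindex : φ.ker.FiniteIndex := inferInstance
  -- On `φ.ker` the shift in `hBmul` is a multiple of the block length, so it conjugates by a power
  -- of the first generator; the second factor absorbs this twist.
  let f : φ.ker →* FreeGroup (Fin 2) := MonoidHom.mk'
    (fun h => B h k * FreeGroup.of 0 ^ ((χ h).toAdd / (2 * D + 1))) (by
      rintro ⟨g, hg⟩ ⟨h, hh⟩
      obtain ⟨a, ha⟩ := (hφ g).1 hg
      obtain ⟨b, hb⟩ := (hφ h).1 hh
      have hp : (2 * D + 1 : ℤ) ≠ 0 := by omega
      simp only [Subgroup.coe_mul, map_mul, toAdd_mul, hBmul, ha, hb, hBadd', ← mul_add,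
        Int.mul_ediv_cancel_left _ hp, MulAut.conj_apply, zpow_add]
      group)
  obtain ⟨z, hz⟩ := hχ (Multiplicative.ofAdd (2 * D + 1))
  have hwk : P.proj w ∈ φ.ker := (hφ _).2 (by rw [hw]; simp)
  have hzk : z ∈ φ.ker := (hφ _).2 (by rw [hz, toAdd_ofAdd])
  refine IsLargeGroup.of_not_commute φ.ker f ⟨z, hzk⟩ ⟨P.proj w, hwk⟩ ?_
  have hfw : f ⟨P.proj w, hwk⟩ = FreeGroup.of 1 ^ (pathLabel (χ.comp P.proj)
      (fun i l => Multiplicative.ofAdd (c i l)) w k).toAdd := by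
    simp only [f, MonoidHom.mk'_apply, hw, toAdd_one, Int.zero_ediv, zpow_zero, mul_one]
    rw [hB, pathLabel_blockLabel hD hDw _ hM _ (hR _), blockIndex_eq_zero hDk]
    simp
  rw [hfw]
  refine not_commute_zpow_of_exponent_eq_one _ _ (fun h => hk (toAdd_eq_zero.1 h)) ?_
  obtain ⟨v, rfl⟩ := P.proj_surjective z
  have hp : (2 * D + 1 : ℤ) ≠ 0 := by omega
  simp only [f, MonoidHom.mk'_apply, hz, toAdd_ofAdd, Int.ediv_self hp, map_mul, hB,
    exponent_pathLabel_blockLabel, zpow_one]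
  simp

end Cover

/-! ### Vanishing minors and the kernel of a matrix. -/

section Minor

theorem exists_orderEmbedding_linearIndependent {K V : Type*} [Field K] [AddCommGroup V]
    [Module K V] {n r : ℕ} (v : Fin n → V)
    (hr : r ≤ Module.finrank K (Submodule.span K (Set.range v))) :
    ∃ s : Fin r ↪o Fin n, LinearIndependent K (v ∘ s) := by
  classical
  obtain ⟨κ, a, ha, hspan, hli⟩ := exists_linearIndependent' K v
  have : Fintype κ := Fintype.ofInjective a ha
  rw [← hspan, finrank_span_eq_card hli, ← Finset.card_univ,
    ← Finset.card_map ⟨a, ha⟩] at hr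
  obtain ⟨t, ht, hcard⟩ := Finset.exists_subset_card_eq hr
  refine ⟨t.orderEmbOfFin hcard, ?_⟩
  have hmem : ∀ i, ∃ x, a x = t.orderEmbOfFin hcard i := by
    intro i
    obtain ⟨x, -, hx⟩ := Finset.mem_map.1 (ht (t.orderEmbOfFin_mem hcard i))
    exact ⟨x, hx⟩
  choose b hb using hmem
  have hcomp : v ∘ t.orderEmbOfFin hcard = (v ∘ a) ∘ b := by
    ext i
    simp [hb]
  rw [hcomp]
  refine hli.comp b fun i j hij => (t.orderEmbOfFin hcard).injective ?_
  rw [← hb, ← hb, hij]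

/-- A matrix of rank at least `r` has a nonzero `r × r` minor. -/
theorem Matrix.exists_minor_ne_zero {K : Type*} [Field K] {m n r : ℕ}
    (A : Matrix (Fin m) (Fin n) K) (hr : r ≤ A.rank) :
    ∃ (s : Fin r ↪o Fin m) (t : Fin r ↪o Fin n), (A.submatrix s t).det ≠ 0 := by
  obtain ⟨s, hs⟩ := exists_orderEmbedding_linearIndependent (r := r) A.row
    (by rwa [← A.rank_eq_finrank_span_row])
  have hrank : (A.submatrix s id).rank = r := by
    rw [LinearIndependent.rank_matrix (M := A.submatrix s id) hs, Fintype.card_fin]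
  obtain ⟨t, ht⟩ := exists_orderEmbedding_linearIndependent (r := r) (A.submatrix s id).col
    (by rw [← Matrix.rank_eq_finrank_span_cols, hrank])
  refine ⟨s, t, ?_⟩
  have hunit : IsUnit (A.submatrix s t) := Matrix.linearIndependent_cols_iff_isUnit.1 ht
  exact ((Matrix.isUnit_iff_isUnit_det _).1 hunit).ne_zero

/-- If a matrix with `n` columns has no nonzero minor of size `n - 1`, its kernel is not
contained in a line. -/
theorem Matrix.exists_mulVec_eq_zero_of_minors_eq_zero {R K : Type*} [CommRing R] [IsDomain R]
    [Field K] [Algebra R K] [IsFractionRing R K] {m n : ℕ} (A : Matrix (Fin m) (Fin n) R)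
    (hn : 0 < n)
    (hA : ∀ (s : Fin (n - 1) ↪o Fin m) (t : Fin (n - 1) ↪o Fin n), (A.submatrix s t).det = 0)
    (u : Fin n → R) :
    ∃ c : Fin n → R, A.mulVec c = 0 ∧ ∀ x y : R, x ≠ 0 → x • c ≠ y • u := by
  let B : Matrix (Fin m) (Fin n) K := A.map (algebraMap R K)
  have hinj : Function.Injective (algebraMap R K) := IsFractionRing.injective R K
  have hrank : B.rank < n - 1 := by
    by_contra! h
    obtain ⟨s, t, hst⟩ := B.exists_minor_ne_zero h
    apply hst
    have := (RingHom.map_det (algebraMap R K) (A.submatrix s t)).symm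
    rw [hA, map_zero] at this
    exact this
  -- By rank–nullity the kernel has dimension at least two.
  have hker : ¬ LinearMap.ker B.mulVecLin ≤
      Submodule.span K {fun i => algebraMap R K (u i)} := by
    intro hle
    have h1 := (Submodule.finrank_mono hle).trans (finrank_span_le_card _)
    rw [Set.toFinset_singleton, Finset.card_singleton] at h1
    have h2 := LinearMap.finrank_range_add_finrank_ker B.mulVecLin
    rw [Module.finrank_fin_fun] at h2
    change B.rank + _ = n at h2
    omega
  obtain ⟨v, hv, hvu⟩ := SetLike.not_le_iff_exists.1 hker
  obtain ⟨b, hb⟩ := IsLocalization.exist_integer_multiples_of_finite (nonZeroDivisors R) v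
  choose c hc using hb
  have hb0 : algebraMap R K b ≠ 0 := by
    rw [Ne, map_eq_zero_iff _ hinj]
    exact nonZeroDivisors.coe_ne_zero b
  have hcv : (fun i => algebraMap R K (c i)) = algebraMap R K b • v := by
    ext i
    rw [hc, Algebra.smul_def, Pi.smul_apply, smul_eq_mul]
  refine ⟨c, ?_, fun x y hx hxy => hvu ?_⟩
  · ext i
    apply hinj
    rw [RingHom.map_mulVec]
    change B.mulVec (fun i => algebraMap R K (c i)) i = _
    rw [hcv, Matrix.mulVec_smul, show B.mulVec v = 0 from hv]
    simp
  · have hx0 : algebraMap R K x ≠ 0 := by rwa [Ne, map_eq_zero_iff _ hinj]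
    rw [Submodule.mem_span_singleton]
    refine ⟨algebraMap R K y / (algebraMap R K x * algebraMap R K b), ?_⟩
    ext i
    have h1 := congrArg (algebraMap R K) (congrFun hxy i)
    have h2 := congrFun hcv i
    simp only [Pi.smul_apply, smul_eq_mul, map_mul] at h1 h2 ⊢
    rw [h2] at h1
    field_simp
    linear_combination -h1

end Minor

/-! ### Fox derivations, the Alexander polynomial and deficiency. -/

namespace FinitePresentation

variable {G : Type*} [Group G] (P : FinitePresentation G)

/-- The image of a combination of the Fox derivatives with coefficients in `ℤ[t, t⁻¹]`: the
derivation that takes the value `c i` at the `i`-th generator. -/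
def foxCombination (χ : G →* Multiplicative ℤ) (c : Fin P.numGen → ℤ[T;T⁻¹])
    (w : FreeGroup (Fin P.numGen)) : ℤ[T;T⁻¹] :=
  ∑ i, P.evalHom χ (foxDerivative i w) * c i

variable (χ : G →* Multiplicative ℤ) (c : Fin P.numGen → ℤ[T;T⁻¹])

theorem foxCombination_of (i : Fin P.numGen) : P.foxCombination χ c (FreeGroup.of i) = c i := by
  simp [foxCombination, foxDerivative_of, apply_ite (P.evalHom χ)]

theorem foxCombination_mul (u v : FreeGroup (Fin P.numGen)) :
    P.foxCombination χ c (u * v) = P.foxCombination χ c u +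
      LaurentPolynomial.T (χ (P.proj u)).toAdd * P.foxCombination χ c v := by
  simp only [foxCombination, foxDerivative_mul, map_add, map_mul, evalHom_of, add_mul,
    Finset.sum_add_distrib, Finset.mul_sum, mul_assoc]

theorem foxCombination_one : P.foxCombination χ c 1 = 0 := by
  simpa using P.foxCombination_mul χ c 1 1

theorem foxCombination_rel (j : Fin P.numRel) :
    P.foxCombination χ c (P.rel j) = (P.alexanderMatrix χ).mulVec c j := rfl

theorem coeff_T_mul (n k : ℤ) (f : ℤ[T;T⁻¹]) :
    (LaurentPolynomial.T n * f).coeff k = f.coeff (k - n) := by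
  rw [LaurentPolynomial.T, AddMonoidAlgebra.coeff_single_mul_apply, one_mul, neg_add_eq_sub]

/-- Both sides obey the same product rule. The signs arise because multiplying by `T n` reads the
coefficient at `k - n`, whereas a path moves its base point forward to `k + n`. -/
theorem pathLabel_coeff (w : FreeGroup (Fin P.numGen)) (k : ℤ) :
    pathLabel (χ.comp P.proj) (fun i l => Multiplicative.ofAdd ((c i).coeff (-l))) w k =
      Multiplicative.ofAdd ((P.foxCombination χ c w).coeff (-k)) := by
  have hmul : ∀ u v k, Multiplicative.ofAdd ((P.foxCombination χ c (u * v)).coeff (-k)) =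
      Multiplicative.ofAdd ((P.foxCombination χ c u).coeff (-k)) *
      Multiplicative.ofAdd
        ((P.foxCombination χ c v).coeff (-(k + ((χ.comp P.proj) u).toAdd))) := by
    intro u v k
    rw [foxCombination_mul, AddMonoidAlgebra.coeff_add, Finsupp.add_apply, coeff_T_mul, ofAdd_add,
      neg_add']
    rfl
  induction w using FreeGroup.induction_on generalizing k with
  | C1 => simp [foxCombination_one]
  | of i => simp [foxCombination_of]
  | inv_of i h =>
    rw [pathLabel_inv, h, inv_eq_iff_mul_eq_one, ← ofAdd_zero]
    have := hmul (FreeGroup.of i)⁻¹ (FreeGroup.of i) k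
    rw [inv_mul_cancel, foxCombination_one, map_inv, toAdd_inv, ← sub_eq_add_neg] at this
    rw [mul_comm]
    exact this.symm
  | mul u v hu hv => rw [pathLabel_mul, hu, hv, hmul]

/-- A derivation that vanishes on the kernel of `χ` is principal up to a factor `t - 1`. -/
theorem sub_one_mul_eq_of_foxCombination_eq_zero (hχ : Function.Surjective χ)
    (hc : ∀ w, χ (P.proj w) = 1 → P.foxCombination χ c w = 0) :
    ∃ y : ℤ[T;T⁻¹], (LaurentPolynomial.T 1 - 1 : ℤ[T;T⁻¹]) • c = y • fun i =>
      (LaurentPolynomial.T (χ (P.proj (FreeGroup.of i))).toAdd - 1 : ℤ[T;T⁻¹]) := by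
  have heq : ∀ u v, χ (P.proj u) = χ (P.proj v) →
      P.foxCombination χ c u = P.foxCombination χ c v := by
    intro u v huv
    have h1 : χ (P.proj (u * v⁻¹)) = 1 := by simp [huv]
    have h2 := P.foxCombination_mul χ c (u * v⁻¹) v
    rwa [inv_mul_cancel_right, hc _ h1, h1, toAdd_one, LaurentPolynomial.T_zero, one_mul,
      zero_add] at h2
  obtain ⟨g, hg⟩ := hχ (Multiplicative.ofAdd 1)
  obtain ⟨x, rfl⟩ := P.proj_surjective g
  refine ⟨P.foxCombination χ c x, funext fun i => ?_⟩
  -- The two products have equal image under `χ`; expanding both sides with `χ(x) = 1` in `ℤ` gives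
  -- the relation, with the value at `x` as `y`.
  have h := heq (FreeGroup.of i * x) (x * FreeGroup.of i) (by simp [mul_comm])
  rw [foxCombination_mul, foxCombination_mul, foxCombination_of, hg, toAdd_ofAdd] at h
  simp only [Pi.smul_apply, smul_eq_mul]
  linear_combination -h

theorem numGen_pos (hχ : Function.Surjective χ) : 0 < P.numGen := by
  by_contra! h
  have : IsEmpty (Fin P.numGen) := ⟨fun i => by have := i.isLt; omega⟩
  have : Subsingleton (Multiplicative ℤ) := (hχ.comp P.proj_surjective).subsingleton
  exact not_subsingleton _ this

theorem T_one_sub_one_ne_zero : (LaurentPolynomial.T 1 - 1 : ℤ[T;T⁻¹]) ≠ 0 := by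
  rw [← LaurentPolynomial.T_zero, sub_ne_zero]
  intro h
  simpa using congrArg (fun f : ℤ[T;T⁻¹] => f.coeff 0) h

/-- A group whose Alexander polynomial relative to some surjection onto `ℤ` vanishes is large. -/
theorem isLargeGroup_of_relAlexanderPolynomial_eq_zero (hχ : Function.Surjective χ)
    (h0 : P.relAlexanderPolynomial χ = 0) : IsLargeGroup G := by
  have hminor : ∀ (s : Fin (P.numGen - 1) ↪o Fin P.numRel)
      (t : Fin (P.numGen - 1) ↪o Fin P.numGen), ((P.alexanderMatrix χ).submatrix s t).det = 0 := fun s t =>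
    zero_dvd_iff.1 ((dvd_laurentGCD_iff (P.alexanderMinor χ) 0).1 (zero_dvd_iff.2 h0) (s, t))
  obtain ⟨c, hker, hc⟩ := Matrix.exists_mulVec_eq_zero_of_minors_eq_zero
    (K := FractionRing ℤ[T;T⁻¹]) (P.alexanderMatrix χ) (P.numGen_pos χ hχ) hminor fun i =>
      (LaurentPolynomial.T (χ (P.proj (FreeGroup.of i))).toAdd - 1 : ℤ[T;T⁻¹])
  obtain ⟨w, hw, hw0⟩ : ∃ w, χ (P.proj w) = 1 ∧ P.foxCombination χ c w ≠ 0 := by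
    by_contra! h
    obtain ⟨y, hy⟩ := P.sub_one_mul_eq_of_foxCombination_eq_zero χ c hχ h
    exact hc _ y T_one_sub_one_ne_zero hy
  obtain ⟨k, hk⟩ : ∃ k, (P.foxCombination χ c w).coeff k ≠ 0 := by
    by_contra! h
    exact hw0 (LaurentPolynomial.ext h)
  refine P.isLargeGroup_of_pathLabel χ hχ (fun i l => (c i).coeff (-l)) ?_ (fun j l => ?_) w hw
    (-k) ?_
  -- A crude bound for all exponents occurring in `c`.
  · refine ⟨∑ i, ∑ x ∈ (c i).coeff.support, |x|, fun i x hx => ?_⟩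
    by_contra h
    refine hx.not_ge ?_
    rw [← abs_neg]
    exact (Finset.single_le_sum (f := fun x : ℤ => |x|) (fun _ _ => abs_nonneg _)
      (Finsupp.mem_support_iff.2 h)).trans
      (Finset.single_le_sum (f := fun i => ∑ x ∈ (c i).coeff.support, |x|)
        (fun _ _ => Finset.sum_nonneg fun _ _ => abs_nonneg _) (Finset.mem_univ i))
  · rw [pathLabel_coeff, foxCombination_rel, hker]
    simp
  · rw [pathLabel_coeff, neg_neg]
    exact fun h => hk (ofAdd_eq_one.1 h)

/-- With `m < n - 1` there is no choice of `n - 1` rows, so the family of minors is empty. -/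
theorem relAlexanderPolynomial_eq_zero_of_two_le_deficiency (h : 2 ≤ P.deficiency) :
    P.relAlexanderPolynomial χ = 0 := by
  refine zero_dvd_iff.1 ((dvd_laurentGCD_iff _ 0).2 fun s => ?_)
  have := Fintype.card_le_of_embedding s.1.toEmbedding
  simp only [Fintype.card_fin] at this
  unfold deficiency at h
  omega

/-- A group with more generators than relators maps onto `ℤ`. -/
theorem exists_surjective_of_numRel_lt_numGen (h : P.numRel < P.numGen) :
    ∃ χ : G →* Multiplicative ℤ, Function.Surjective χ := by
  let Φ : (Fin P.numGen → ℤ) →+ (Fin P.numRel → ℤ) := AddMonoidHom.mk'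
    (fun e j => (FreeGroup.lift (fun i => Multiplicative.ofAdd (e i)) (P.rel j)).toAdd) (by
      intro e e'
      ext j
      have : FreeGroup.lift (fun i => Multiplicative.ofAdd ((e + e') i)) =
          FreeGroup.lift (fun i => Multiplicative.ofAdd (e i)) *
            FreeGroup.lift (fun i => Multiplicative.ofAdd (e' i)) := by
        ext i
        simp
      rw [this]
      rfl)
  -- There are more unknown generator values than linear conditions from the relators.
  obtain ⟨e, he, he0⟩ : ∃ e, Φ e = 0 ∧ e ≠ 0 := by
    by_contra! hΦ
    have hinj : Function.Injective Φ.toIntLinearMap :=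
      (injective_iff_map_eq_zero Φ).2 hΦ
    have := LinearMap.finrank_le_finrank_of_injective hinj
    rw [Module.finrank_fin_fun, Module.finrank_fin_fun] at this
    omega
  let ε : FreeGroup (Fin P.numGen) →* Multiplicative ℤ :=
    FreeGroup.lift fun i => Multiplicative.ofAdd (e i)
  have hker : P.proj.ker ≤ ε.ker := by
    rw [P.ker_proj]
    refine Subgroup.normalClosure_le_normal ?_
    rintro _ ⟨j, rfl⟩
    exact congrFun he j
  let χ₀ := P.proj.liftOfSurjective P.proj_surjective ⟨ε, hker⟩
  obtain ⟨i, hi⟩ := Function.ne_iff.1 he0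
  have hχ₀ : χ₀ (P.proj (FreeGroup.of i)) = Multiplicative.ofAdd (e i) := by
    simp [χ₀, MonoidHom.liftOfRightInverse_comp_apply, ε]
  -- The image of `χ₀` may be a proper subgroup of `ℤ`; being infinite cyclic, it is identified with
  -- `ℤ`.
  have : Infinite χ₀.range := by
    refine Infinite.of_injective
      (fun n : ℤ => χ₀.rangeRestrict (P.proj (FreeGroup.of i)) ^ n) fun a b hab => ?_
    have h1 := congrArg (fun x : χ₀.range => (x : Multiplicative ℤ).toAdd) hab
    simp only [SubgroupClass.coe_zpow, MonoidHom.coe_rangeRestrict, hχ₀, toAdd_zpow, toAdd_ofAdd,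
      smul_eq_mul] at h1
    exact mul_right_cancel₀ hi h1
  exact ⟨(intCyclicMulEquiv (G := χ₀.range)).symm.toMonoidHom.comp χ₀.rangeRestrict,
    (intCyclicMulEquiv (G := χ₀.range)).symm.surjective.comp χ₀.rangeRestrict_surjective⟩

end FinitePresentation

theorem theorem2p3 {G : Type*} [Group G] (P : FinitePresentation G) :
    (∀ χ : G →* Multiplicative ℤ, Function.Surjective χ →
      P.relAlexanderPolynomial χ = 0 → IsLargeGroup G) ∧
    (2 ≤ P.deficiency →
      (∃ χ : G →* Multiplicative ℤ, Function.Surjective χ ∧ P.relAlexanderPolynomial χ = 0) ∧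
      IsLargeGroup G) := by
  refine ⟨fun χ hχ h0 => P.isLargeGroup_of_relAlexanderPolynomial_eq_zero χ hχ h0, fun h => ?_⟩
  obtain ⟨χ, hχ⟩ := P.exists_surjective_of_numRel_lt_numGen (by
    unfold FinitePresentation.deficiency at h
    omega)
  have h0 := P.relAlexanderPolynomial_eq_zero_of_two_le_deficiency χ h
  exact ⟨⟨χ, hχ, h0⟩, P.isLargeGroup_of_relAlexanderPolynomial_eq_zero χ hχ h0⟩

end
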